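/- **Conventions.** An undirected graph with legs consists of finite sets $V$ (vertices) and $E$ (edges) and a function $\mathrm{nbhd}:V\to\mathcal P(E)$ such that each edge lies in at most two of the sets $\mathrm{nbhd}(v)$. An edge is interior if it lies in $\mathrm{nbhd}(v)\cap\mathrm{nbhd}(w)$ for some $v\ne w$; all other edges are legs. A tree is a contractible graph with legs that has at least one leg, together with an ordering of each $\mathrm{nbhd}(v)$ and an ordering of the set of legs; $\eta$ is the tree with one edge and no vertex (pinned by the unique map from $\{0,1\}$ to its edge). A subgraph of a tree $S$ is a pair of subsets $V'\subseteq V(S)$, $E'\subseteq E(S)$ with $\mathrm{nbhd}(v)\subseteq E'$ for all $v\in V'$ and such that $(V',E',\mathrm{nbhd})$ is contractible; $|_e$ is the subgraph consisting of the single edge $e$, and $\star_v=(\{v\},\mathrm{nbhd}(v))$. The boundary $\partial(T)$ of a subgraph $T$ is the unordered list $e,e$ if $T=|_e$, and the list of the legs of $T$ (each once) otherwise. Let $\Xi$ be the category whose objects are trees and whose morphisms $\phi:R\to S$ are pairs of functions $\phi_0:E(R)\to E(S)$ and $\phi_1:V(R)\to\{\text{subgraphs of }S\}$ such that (1) $\phi_0|_{\mathrm{nbhd}(v)}$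 is injective if $|\mathrm{nbhd}(v)|\neq 2$; (2) $\partial(\phi_1(v))$ is the unordered list $\phi_0(\mathrm{nbhd}(v))$, counted with multiplicity; (3) $\phi_1(v)$ and $\phi_1(w)$ have no common vertex if $v\ne w$. For a subgraph $T$ of $R$, $\mathrm{im}(\phi|_T)$ is the subgraph $\bigcup_{v\in V(T)}\phi_1(v)$ of $S$ if $T$ has a vertex, and is $|_{\phi_0(e)}$ if $T=|_e$; $\mathrm{im}(\phi)=\mathrm{im}(\phi|_R)$. Composition is given by $(\psi\phi)_0=\psi_0\phi_0$ and $(\psi\phi)_1(v)=\mathrm{im}(\psi|_{\phi_1(v)})$; the identity is $(\mathrm{id},\,v\mapsto\star_v)$. A morphism $\phi:R\to S$ is *active* if $\mathrm{im}(\phi)=S$. It is *inert* if $\phi_0$ is injective and, for every vertex $v$ of $R$ and every vertex $w$ of $\phi_1(v)$, $\mathrm{nbhd}(w)\subseteq\phi_0(E(R))$. **Proposition.** The active and the inert morphisms form a weak factorization system on $\Xi$: every morphism is an active morphism followed by an inert one; a morphism is active if and only if it has the left lifting property with respect to all inert morphisms; and a morphism is inert if and only if it has the right lifting property with respect to all active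 morphisms. Moreover, every morphism $\phi:R\to S$ factors through its image: for every choice of an ordering of the legs of $\mathrm{im}(\phi)$ (with vertex orderings inherited from $S$), the inclusion $\mathrm{im}(\phi)\to S$ is inert and $\phi$ is the composition of an active morphism $R\to\mathrm{im}(\phi)$ with this inclusion. -/

import Mathlib

open CategoryTheory

universe u

namespace CyclicTree

/-! ## Graphs with legs -/

/-- An undirected graph with legs: finite sets of vertices and edges and a function `nbhd` from
vertices to sets of edges, such that every edge is incident to at most two vertices. -/
structure LegGraph : Type (u + 1) where
  V : Type u
  E : Type u
  finV : Finite V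
  finE : Finite E
  nbhd : V → Set E
  incident_le_two : ∀ e : E, {v | e ∈ nbhd v}.ncard ≤ 2

attribute [instance] LegGraph.finV LegGraph.finE

namespace LegGraph

variable (G : LegGraph.{u})

/-- The interior edges: those incident to two different vertices. -/
def interior : Set G.E := {e | ∃ v w, v ≠ w ∧ e ∈ G.nbhd v ∧ e ∈ G.nbhd w}

/-- The legs: edges that are not interior. -/
def legs : Set G.E := G.interiorᶜ

/-- The incidence graph: an ordinary simple graph on `V ⊕ E` in which a vertex `v` is adjacent to
an edge `e` exactly when `e ∈ nbhd v`. -/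
def incidence : SimpleGraph (G.V ⊕ G.E) where
  Adj
    | .inl v, .inr e => e ∈ G.nbhd v
    | .inr e, .inl v => e ∈ G.nbhd v
    | _, _ => False
  symm := ⟨by rintro (v | e) (w | f) h <;> exact h⟩
  loopless := ⟨by rintro (v | e) h <;> exact h⟩

/-- A graph with legs is contractible, as a one-dimensional space, exactly when its incidence
graph (its subdivision at the edges, with the free ends of the legs retracted) is a tree in the
usual sense: connected (in particular nonempty) and without cycles. -/
def IsContractible : Prop := G.incidence.IsTree

/-- The graph with legs `(V, E, nbhd)` given by a subset of the vertices and a subset of the edges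
that contains all edges incident to the chosen vertices. -/
def restrict (V : Set G.V) (E : Set G.E) (_h : ∀ v ∈ V, G.nbhd v ⊆ E) : LegGraph.{u} where
  V := V
  E := E
  finV := inferInstance
  finE := inferInstance
  nbhd v := {e | (e : G.E) ∈ G.nbhd v}
  incident_le_two e := by
    refine le_trans ?_ (G.incident_le_two e)
    exact Set.ncard_le_ncard_of_injOn (fun v => (v : G.V)) (fun v hv => hv)
      (fun _ _ _ _ h => Subtype.ext h) (Set.toFinite _)

end LegGraph

/-! ## Trees -/

/-- An unpinned tree: a contractible graph with legs, with at least one leg, together with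
bijections `ord^v : {0, …, n_v} ≃ nbhd v` for all vertices `v`. -/
structure UnpinnedTree : Type (u + 1) extends LegGraph.{u} where
  contractible : toLegGraph.IsContractible
  legs_nonempty : toLegGraph.legs.Nonempty
  lastAt : V → ℕ
  ordAt : ∀ v, Fin (lastAt v + 1) ≃ nbhd v

/-- A pinning of an unpinned tree: a function `ord : {0, …, n} → legs` which is a bijection if the
tree has a vertex and is otherwise the unique function from `{0, 1}` to the single edge. -/
structure Pinning (U : UnpinnedTree.{u}) : Type u where
  last : ℕ
  ord : Fin (last + 1) → U.legs
  bijective_of_vertex : Nonempty U.V → Function.Bijective ord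
  last_of_no_vertex : IsEmpty U.V → last = 1

/-- The objects of `Ξ`: (pinned) trees. -/
structure Tree : Type (u + 1) extends UnpinnedTree.{u} where
  pinning : Pinning toUnpinnedTree

/-! ## Subgraphs of trees -/

/-- A subgraph of a tree: a set of vertices and a set of edges that contains all edges incident to
the chosen vertices, such that the resulting graph is contractible. -/
@[ext] structure Subgraph (S : UnpinnedTree.{u}) : Type u where
  verts : Set S.V
  edges : Set S.E
  closed : ∀ v ∈ verts, S.nbhd v ⊆ edges
  contractible : (S.restrict verts edges closed).IsContractible

section carrier

variable {S : UnpinnedTree.{u}}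

/-- A set of vertices and a set of edges, as a set of nodes of the incidence graph. -/
def nodes (V : Set S.V) (E : Set S.E) : Set (S.V ⊕ S.E) := {x | Sum.elim (· ∈ V) (· ∈ E) x}

@[simp] theorem inl_mem_nodes {V : Set S.V} {E : Set S.E} {v : S.V} :
    Sum.inl v ∈ nodes V E ↔ v ∈ V := Iff.rfl

@[simp] theorem inr_mem_nodes {V : Set S.V} {E : Set S.E} {e : S.E} :
    Sum.inr e ∈ nodes V E ↔ e ∈ E := Iff.rfl

/-- The incidence graph of a restricted graph is an induced subgraph of the incidence graph. -/
def restrictIso (V : Set S.V) (E : Set S.E) (h : ∀ v ∈ V, S.nbhd v ⊆ E) :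
    (S.restrict V E h).incidence ≃g S.incidence.induce (nodes V E) where
  toFun
    | .inl v => ⟨.inl v.1, v.2⟩
    | .inr e => ⟨.inr e.1, e.2⟩
  invFun
    | ⟨.inl v, hv⟩ => .inl ⟨v, hv⟩
    | ⟨.inr e, he⟩ => .inr ⟨e, he⟩
  left_inv := by rintro (v | e) <;> rfl
  right_inv := by rintro ⟨v | e, h⟩ <;> rfl
  map_rel_iff' := by rintro (v | e) (w | f) <;> exact Iff.rfl

theorem contractible_of_connected (V : Set S.V) (E : Set S.E) (h : ∀ v ∈ V, S.nbhd v ⊆ E)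
    (hc : (S.incidence.induce (nodes V E)).Connected) : (S.restrict V E h).IsContractible :=
  (SimpleGraph.Iso.isTree_iff (restrictIso V E h)).2 ⟨hc, S.contractible.isAcyclic.induce _⟩

theorem Subgraph.connected (T : Subgraph S) :
    (S.incidence.induce (nodes T.verts T.edges)).Connected :=
  ((SimpleGraph.Iso.isTree_iff (restrictIso T.verts T.edges T.closed)).1 T.contractible).connected

end carrier

namespace Subgraph

variable {S : UnpinnedTree.{u}}

/-- The whole tree, as a subgraph of itself. -/
def whole (S : UnpinnedTree.{u}) : Subgraph S where
  verts := Set.univ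
  edges := Set.univ
  closed _ _ := Set.subset_univ _
  contractible := contractible_of_connected _ _ _ (by
    have h : nodes (S := S) Set.univ Set.univ = Set.univ := by
      ext (v | e) <;> simp
    rw [h]
    exact (SimpleGraph.Iso.connected_iff (SimpleGraph.induceUnivIso _)).2 S.contractible.connected)

/-- The subgraph `|_e` consisting of the single edge `e`. -/
def single (e : S.E) : Subgraph S where
  verts := ∅
  edges := {e}
  closed _ h := h.elim
  contractible := contractible_of_connected _ _ _ (by
    have h : nodes (S := S) ∅ {e} = {Sum.inr e} := by
      ext (v | f) <;> simp
    rw [h, SimpleGraph.induce_singleton_eq_top]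
    exact SimpleGraph.connected_top)

theorem star_connected (v : S.V) :
    (S.incidence.induce (nodes {v} (S.nbhd v))).Connected := by
  rw [SimpleGraph.connected_iff_exists_forall_reachable]
  refine ⟨⟨Sum.inl v, rfl⟩, ?_⟩
  rintro ⟨w | e, h⟩
  · obtain rfl : w = v := h
    exact SimpleGraph.Reachable.refl _
  · exact SimpleGraph.Adj.reachable (show e ∈ S.nbhd v from h)

/-- The subgraph `⋆_v` consisting of the vertex `v` and all edges incident to it. -/
def star (v : S.V) : Subgraph S where
  verts := {v}
  edges := S.nbhd v
  closed := by rintro w rfl; exact subset_rfl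
  contractible := contractible_of_connected _ _ _ (star_connected v)

/-- The interior edges of a subgraph. -/
def interior (T : Subgraph S) : Set S.E :=
  {e | ∃ v ∈ T.verts, ∃ w ∈ T.verts, v ≠ w ∧ e ∈ S.nbhd v ∧ e ∈ S.nbhd w}

/-- The legs of a subgraph. -/
def legs (T : Subgraph S) : Set S.E := T.edges \ T.interior

open Classical in
/-- The boundary of a subgraph, an unordered list of edges: `e²` if the subgraph is a single edge
`e`, and the list of the legs (each occurring once) otherwise. -/
noncomputable def boundary (T : Subgraph S) : Multiset S.E :=
  if T.verts = ∅ then 2 • (Set.toFinite T.edges).toFinset.val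
  else (Set.toFinite T.legs).toFinset.val

end Subgraph

/-- The neighbourhood of a vertex, as an unordered list. -/
noncomputable def nbhdList (S : UnpinnedTree.{u}) (v : S.V) : Multiset S.E :=
  (Set.toFinite (S.nbhd v)).toFinset.val

/-! ## Morphisms -/

/-- A morphism of trees `φ : R → S`: a function `φ₀` from edges to edges and a function `φ₁` from
the vertices of `R` to the subgraphs of `S`, such that `φ₀` is injective on neighbourhoods of
vertices that are not bivalent, the boundary of `φ₁ v` is the image of `nbhd v` under `φ₀` (as
unordered lists; a single edge occurs twice in its boundary), and different vertices go to
subgraphs with disjoint sets of vertices. Orderings play no role. -/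
@[ext] structure Morphism (R S : UnpinnedTree.{u}) : Type u where
  edge : R.E → S.E
  sub : R.V → Subgraph S
  injOn_nbhd : ∀ v, (R.nbhd v).ncard ≠ 2 → Set.InjOn edge (R.nbhd v)
  boundary_sub : ∀ v, (sub v).boundary = (nbhdList R v).map edge
  disjoint_sub : ∀ v w, v ≠ w → Disjoint (sub v).verts (sub w).verts

namespace Subgraph

variable {S : UnpinnedTree.{u}}

theorem ordAt_nonempty (v : S.V) : (S.nbhd v).Nonempty :=
  ⟨_, (S.ordAt v 0).2⟩

theorem ext_nodes {A B : Subgraph S}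
    (h : ∀ x, x ∈ nodes A.verts A.edges ↔ x ∈ nodes B.verts B.edges) : A = B :=
  Subgraph.ext (Set.ext fun v => h (.inl v)) (Set.ext fun e => h (.inr e))

theorem edges_nonempty (T : Subgraph S) : T.edges.Nonempty := by
  obtain ⟨⟨v | e, h⟩⟩ := T.connected.nonempty
  · exact (ordAt_nonempty v).mono (T.closed v h)
  · exact ⟨e, h⟩

/-- If a subgraph of `T` (a nonempty closed set of nodes) is not all of `T`, then some edge in it
is incident to a vertex of `T` outside it. -/
theorem exists_crossing (T : Subgraph S) {W : Set S.V} {F : Set S.E}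
    (hcl : ∀ v ∈ W, S.nbhd v ⊆ F) {e₀ : S.E} (he₀ : e₀ ∈ F) (he₀T : e₀ ∈ T.edges)
    {x : S.V ⊕ S.E} (hx : x ∈ nodes T.verts T.edges) (hxW : x ∉ nodes W F) :
    ∃ e ∈ F, e ∈ T.edges ∧ ∃ v ∈ T.verts, v ∉ W ∧ e ∈ S.nbhd v := by
  obtain ⟨p⟩ := T.connected.preconnected ⟨Sum.inr e₀, he₀T⟩ ⟨x, hx⟩
  obtain ⟨d, -, h1, h2⟩ := p.exists_boundary_dart {y | y.1 ∈ nodes W F} he₀ hxW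
  obtain ⟨⟨⟨a, ha⟩, ⟨b, hb⟩⟩, hadj⟩ := d
  rcases a with v | e <;> rcases b with w | f
  · exact hadj.elim
  · exact (h2 (hcl v h1 hadj)).elim
  · exact ⟨e, h1, ha, w, hb, h2, hadj⟩
  · exact hadj.elim

theorem union_connected (A B : Subgraph S) {e : S.E} (hA : e ∈ A.edges) (hB : e ∈ B.edges) :
    (S.incidence.induce (nodes (A.verts ∪ B.verts) (A.edges ∪ B.edges))).Connected := by
  have h : nodes (A.verts ∪ B.verts) (A.edges ∪ B.edges)
      = nodes A.verts A.edges ∪ nodes B.verts B.edges := by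
    ext (v | f) <;> simp
  rw [h]
  exact SimpleGraph.induce_union_connected A.connected.preconnected B.connected.preconnected
    ⟨Sum.inr e, hA, hB⟩

/-- The union of two subgraphs with a common edge. -/
def join (A B : Subgraph S) (e : S.E) (hA : e ∈ A.edges) (hB : e ∈ B.edges) : Subgraph S where
  verts := A.verts ∪ B.verts
  edges := A.edges ∪ B.edges
  closed := by
    rintro v (h | h)
    · exact (A.closed v h).trans Set.subset_union_left
    · exact (B.closed v h).trans Set.subset_union_right
  contractible := contractible_of_connected _ _ _ (A.union_connected B hA hB)

/-- Subgraphs are built from single edges by attaching vertices one at a time. -/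
theorem induction {P : Subgraph S → Prop} (hsingle : ∀ e, P (single e))
    (hjoin : ∀ (U : Subgraph S) (v : S.V) (e : S.E) (_ : v ∉ U.verts) (hU : e ∈ U.edges)
      (hv : e ∈ S.nbhd v), P U → P (U.join (star v) e hU hv)) (T : Subgraph S) : P T := by
  classical
  obtain ⟨e₀, he₀⟩ := T.edges_nonempty
  have key : ∀ n : ℕ, ∀ U : Subgraph S, e₀ ∈ U.edges → U.verts ⊆ T.verts → U.edges ⊆ T.edges →
      P U → (T.verts \ U.verts).ncard = n → P T := by
    intro n
    induction n using Nat.strong_induction_on with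
    | _ n ih =>
      intro U h0 hV hE hP hn
      by_cases hx : ∃ x, x ∈ nodes T.verts T.edges ∧ x ∉ nodes U.verts U.edges
      · obtain ⟨x, hx, hxU⟩ := hx
        obtain ⟨e, heU, -, v, hvT, hvU, hev⟩ := T.exists_crossing U.closed h0 he₀ hx hxU
        refine ih _ ?_ (U.join (star v) e heU hev) (Or.inl h0) ?_ ?_
          (hjoin U v e hvU heU hev hP) rfl
        · rw [← hn]
          refine Set.ncard_lt_ncard ?_ (Set.toFinite _)
          refine ⟨fun w hw => ⟨hw.1, fun h => hw.2 (Or.inl h)⟩, fun h => ?_⟩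
          exact (h ⟨hvT, hvU⟩).2 (Or.inr rfl)
        · exact Set.union_subset hV (Set.singleton_subset_iff.2 hvT)
        · exact Set.union_subset hE (T.closed v hvT)
      · push Not at hx
        have : U = T := ext_nodes fun x => ⟨by
          rcases x with v | e
          · exact fun h => hV h
          · exact fun h => hE h, hx x⟩
        exact this ▸ hP
  exact key _ (single e₀) rfl (Set.empty_subset _) (Set.singleton_subset_iff.2 he₀)
    (hsingle e₀) rfl

/-- Two subgraphs without common vertices have at most one common edge. -/
theorem edges_inter_subsingleton (A B : Subgraph S) (hd : Disjoint A.verts B.verts) {e f : S.E}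
    (heA : e ∈ A.edges) (heB : e ∈ B.edges) (hfA : f ∈ A.edges) (hfB : f ∈ B.edges) :
    e = f := by
  classical
  by_contra hne
  have walk : ∀ C : Subgraph S, e ∈ C.edges → f ∈ C.edges →
      ∃ p : S.incidence.Path (.inr e) (.inr f), ∀ x ∈ p.1.support, x ∈ nodes C.verts C.edges := by
    intro C h1 h2
    obtain ⟨q⟩ := C.connected.preconnected ⟨Sum.inr e, h1⟩ ⟨Sum.inr f, h2⟩
    let q' : S.incidence.Walk (.inr e) (.inr f) :=
      q.map (SimpleGraph.Embedding.induce (nodes C.verts C.edges)).toHom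
    refine ⟨q'.toPath, fun x hx => ?_⟩
    have := q'.support_toPath_subset_support hx
    erw [SimpleGraph.Walk.support_map] at this
    rw [List.mem_map] at this
    obtain ⟨y, -, rfl⟩ := this
    exact y.2
  obtain ⟨p, hp⟩ := walk A heA hfA
  obtain ⟨q, hq⟩ := walk B heB hfB
  obtain rfl := (S.contractible.isAcyclic.subsingleton_path _ _).elim p q
  obtain ⟨p, hpath⟩ := p
  cases p with
  | nil => exact hne rfl
  | @cons _ y _ hadj p' =>
    rcases y with v | g
    · have hv : Sum.inl v ∈ (SimpleGraph.Walk.cons hadj p').support := by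
        simp [SimpleGraph.Walk.support_cons]
      exact Set.disjoint_left.1 hd (hp _ hv) (hq _ hv)
    · exact hadj

open Classical in
theorem count_boundary (T : Subgraph S) (e : S.E) :
    T.boundary.count e + {v | v ∈ T.verts ∧ e ∈ S.nbhd v}.ncard
      = if e ∈ T.edges then 2 else 0 := by
  have hle : {v | v ∈ T.verts ∧ e ∈ S.nbhd v}.ncard ≤ 2 :=
    (Set.ncard_le_ncard (fun v hv => hv.2) (Set.toFinite _)).trans (S.incident_le_two e)
  unfold boundary
  split_ifs with hV he he
  · have : {v | v ∈ T.verts ∧ e ∈ S.nbhd v} = ∅ := by simp [hV]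
    rw [this, Set.ncard_empty, Multiset.count_nsmul,
      Multiset.count_eq_one_of_mem (Finset.nodup _) (by simpa using he)]
  · have : {v | v ∈ T.verts ∧ e ∈ S.nbhd v} = ∅ := by simp [hV]
    rw [this, Set.ncard_empty, Multiset.count_nsmul, Multiset.count_eq_zero_of_notMem]
    simpa using he
  · have hpos : 0 < {v | v ∈ T.verts ∧ e ∈ S.nbhd v}.ncard := by
      rw [Set.ncard_pos (Set.toFinite _)]
      obtain ⟨v, hv⟩ := Set.nonempty_iff_ne_empty.2 hV
      obtain ⟨f, hf, -, w, hw, -, hfw⟩ := T.exists_crossing (W := ∅) (F := {e}) (by simp) rfl he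
        (x := Sum.inl v) hv (by simp)
      obtain rfl : f = e := hf
      exact ⟨w, hw, hfw⟩
    by_cases hi : e ∈ T.interior
    · rw [Multiset.count_eq_zero_of_notMem (by simp [legs, hi])]
      obtain ⟨v, hv, w, hw, hne, h1, h2⟩ := hi
      have : 1 < {v | v ∈ T.verts ∧ e ∈ S.nbhd v}.ncard :=
        (Set.one_lt_ncard (Set.toFinite _)).2 ⟨v, ⟨hv, h1⟩, w, ⟨hw, h2⟩, hne⟩
      omega
    · rw [Multiset.count_eq_one_of_mem (Finset.nodup _) (by simp [legs, hi, he])]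
      have : ¬ 1 < {v | v ∈ T.verts ∧ e ∈ S.nbhd v}.ncard := by
        rw [Set.one_lt_ncard (Set.toFinite _)]
        rintro ⟨v, ⟨hv, h1⟩, w, ⟨hw, h2⟩, hne⟩
        exact hi ⟨v, hv, w, hw, hne, h1, h2⟩
      omega
  · have : {v | v ∈ T.verts ∧ e ∈ S.nbhd v} = ∅ := by
      ext v
      simp only [Set.mem_ofPred_eq, Set.mem_empty_iff_false, iff_false, not_and]
      exact fun hv h => he (T.closed v hv h)
    rw [this, Set.ncard_empty, Multiset.count_eq_zero_of_notMem]
    simp [legs, he]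

theorem boundary_glue (A B C : Subgraph S) (hd : Disjoint A.verts B.verts) {e : S.E}
    (hA : e ∈ A.edges) (hB : e ∈ B.edges) (hCV : C.verts = A.verts ∪ B.verts)
    (hCE : C.edges = A.edges ∪ B.edges) :
    C.boundary + 2 • {e} = A.boundary + B.boundary := by
  classical
  ext x
  have hC := C.count_boundary x
  have h1 := A.count_boundary x
  have h2 := B.count_boundary x
  have hdeg : {v | v ∈ C.verts ∧ x ∈ S.nbhd v}.ncard
      = {v | v ∈ A.verts ∧ x ∈ S.nbhd v}.ncard + {v | v ∈ B.verts ∧ x ∈ S.nbhd v}.ncard := by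
    rw [← Set.ncard_union_eq ?_ (Set.toFinite _) (Set.toFinite _)]
    · congr 1
      ext v
      simp only [hCV, Set.mem_union, Set.mem_ofPred_eq]
      tauto
    · exact Set.disjoint_left.2 fun v hv hv' => Set.disjoint_left.1 hd hv.1 hv'.1
  have hxe : x ∈ A.edges → x ∈ B.edges → x = e := fun ha hb =>
    edges_inter_subsingleton A B hd ha hb hA hB
  rw [Multiset.count_add, Multiset.count_add, Multiset.count_nsmul, Multiset.count_singleton]
  rw [hdeg, hCE] at hC
  by_cases hx : x = e
  · subst hx
    simp only [hA, hB, Set.mem_union, or_self, if_true] at hC h1 h2 ⊢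
    omega
  · by_cases ha : x ∈ A.edges <;> by_cases hb : x ∈ B.edges <;>
      simp only [ha, hb, hx, Set.mem_union, or_self, or_true, true_or, if_true, if_false] at hC h1 h2 ⊢
    · exact (hx (hxe ha hb)).elim
    all_goals omega

theorem boundary_single (e : S.E) : (single e).boundary = 2 • {e} := by
  simp [boundary, single]

theorem boundary_star (v : S.V) : (star v).boundary = nbhdList S v := by
  have h : (star v).legs = S.nbhd v := by
    ext e
    simp only [legs, interior, star, Set.mem_sdiff, Set.mem_ofPred_eq, Set.mem_singleton_iff,
      and_iff_left_iff_imp]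
    rintro - ⟨a, rfl, b, rfl, hne, -⟩
    exact hne rfl
  have hne : (star v).verts ≠ ∅ := Set.singleton_ne_empty v
  unfold boundary nbhdList
  rw [if_neg hne]
  simp only [h]

theorem boundary_subset_edges (T : Subgraph S) {e : S.E} (h : e ∈ T.boundary) : e ∈ T.edges := by
  classical
  by_contra he
  have := T.count_boundary e
  rw [if_neg he] at this
  have h' := Multiset.count_pos.2 h
  omega

theorem card_boundary_of_no_vertex (T : Subgraph S) (h : T.verts = ∅) :
    Multiset.card T.boundary = 2 := by
  obtain ⟨e, he⟩ := T.edges_nonempty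
  have hE : T.edges = {e} := by
    refine Set.eq_singleton_iff_unique_mem.2 ⟨he, fun f hf => ?_⟩
    exact T.edges_inter_subsingleton T (by simp [h]) hf hf he he
  have : T = single e := Subgraph.ext h hE
  rw [this, boundary_single]
  simp

theorem boundary_nodup (T : Subgraph S) (h : T.verts ≠ ∅) : T.boundary.Nodup := by
  unfold boundary
  rw [if_neg h]
  exact Finset.nodup _

/-- Every subgraph of a tree has a leg. -/
theorem legs_nonempty (T : Subgraph S) : (S.restrict T.verts T.edges T.closed).legs.Nonempty := by
  classical
  by_contra hcon
  rw [Set.not_nonempty_iff_eq_empty] at hcon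
  have hint : ∀ e ∈ T.edges, ∃ v ∈ T.verts, ∃ w ∈ T.verts, v ≠ w ∧ e ∈ S.nbhd v ∧ e ∈ S.nbhd w := by
    intro e he
    have h1 : (⟨e, he⟩ : T.edges) ∉ (S.restrict T.verts T.edges T.closed).legs := by
      rw [hcon]; exact Set.notMem_empty _
    have h2 : (⟨e, he⟩ : T.edges) ∈ (S.restrict T.verts T.edges T.closed).interior :=
      not_not.1 h1
    obtain ⟨v, w, hne, h3, h4⟩ := h2
    exact ⟨v.1, v.2, w.1, w.2, fun h => hne (Subtype.ext h), h3, h4⟩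
  obtain ⟨e₀, he₀⟩ := T.edges_nonempty
  obtain ⟨l, hl⟩ := S.legs_nonempty
  by_cases hlT : l ∈ T.edges
  · obtain ⟨v, -, w, -, h⟩ := hint l hlT
    exact hl ⟨v, w, h⟩
  · obtain ⟨e, heT, -, u, -, huT, heu⟩ := (whole S).exists_crossing T.closed he₀
      (Set.mem_univ e₀) (x := Sum.inr l) (Set.mem_univ l) hlT
    obtain ⟨v, hv, w, hw, hne, h1, h2⟩ := hint e heT
    have hthree : 2 < {v | e ∈ S.nbhd v}.ncard :=
      (Set.two_lt_ncard (Set.toFinite _)).2 ⟨v, h1, w, h2, u, heu, hne,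
        fun h => huT (h ▸ hv), fun h => huT (h ▸ hw)⟩
    exact absurd (S.incident_le_two e) (by omega)

/-- A subgraph of a tree is an unpinned tree; the orderings at the vertices are inherited. -/
def toUnpinned (T : Subgraph S) : UnpinnedTree.{u} where
  toLegGraph := S.restrict T.verts T.edges T.closed
  contractible := T.contractible
  legs_nonempty := T.legs_nonempty
  lastAt v := S.lastAt v.1
  ordAt v := (S.ordAt v.1).trans
    { toFun := fun e => ⟨⟨e.1, T.closed v.1 v.2 e.2⟩, e.2⟩
      invFun := fun e => ⟨e.1.1, e.2⟩
      left_inv := fun _ => rfl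
      right_inv := fun _ => rfl }

/-- A subgraph of a tree, with a chosen pinning. -/
def toTree (T : Subgraph S) (p : Pinning T.toUnpinned) : Tree.{u} where
  toUnpinnedTree := T.toUnpinned
  pinning := p

end Subgraph

namespace Morphism

variable {R S Q : UnpinnedTree.{u}} (φ : Morphism R S)

theorem edge_mem_sub {v : R.V} {e : R.E} (h : e ∈ R.nbhd v) : φ.edge e ∈ (φ.sub v).edges := by
  apply Subgraph.boundary_subset_edges
  rw [φ.boundary_sub]
  exact Multiset.mem_map_of_mem _ (by simpa [nbhdList] using h)

/-- The vertices of the image of a subgraph. -/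
def imageVerts (T : Subgraph R) : Set S.V := ⋃ v ∈ T.verts, (φ.sub v).verts

/-- The edges of the image of a subgraph. -/
def imageEdges (T : Subgraph R) : Set S.E := φ.edge '' T.edges ∪ ⋃ v ∈ T.verts, (φ.sub v).edges

theorem imageVerts_join (U : Subgraph R) (v : R.V) {e : R.E} (hU : e ∈ U.edges)
    (he : e ∈ R.nbhd v) :
    φ.imageVerts (U.join (Subgraph.star v) e hU he) = φ.imageVerts U ∪ (φ.sub v).verts := by
  change (⋃ w ∈ U.verts ∪ {v}, (φ.sub w).verts) = _
  rw [Set.biUnion_union, Set.biUnion_singleton]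
  rfl

theorem imageEdges_join (U : Subgraph R) (v : R.V) {e : R.E} (hU : e ∈ U.edges)
    (he : e ∈ R.nbhd v) :
    φ.imageEdges (U.join (Subgraph.star v) e hU he) = φ.imageEdges U ∪ (φ.sub v).edges := by
  change φ.edge '' (U.edges ∪ R.nbhd v) ∪ (⋃ w ∈ U.verts ∪ {v}, (φ.sub w).edges) = _
  rw [Set.biUnion_union, Set.biUnion_singleton, Set.image_union, imageEdges]
  ext f
  have : f ∈ φ.edge '' R.nbhd v → f ∈ (φ.sub v).edges := by
    rintro ⟨g, hg, rfl⟩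
    exact φ.edge_mem_sub hg
  simp only [Set.mem_union]
  tauto

theorem image_connected (T : Subgraph R) :
    (S.incidence.induce (nodes (φ.imageVerts T) (φ.imageEdges T))).Connected := by
  induction T using Subgraph.induction with
  | hsingle e =>
    have h1 : φ.imageVerts (Subgraph.single e) = (Subgraph.single (φ.edge e)).verts := by
      simp [imageVerts, Subgraph.single]
    have h2 : φ.imageEdges (Subgraph.single e) = (Subgraph.single (φ.edge e)).edges := by
      simp [imageEdges, Subgraph.single]
    rw [h1, h2]
    exact Subgraph.connected _
  | hjoin U v e hv hU he ih =>
    have h : nodes (φ.imageVerts (U.join (Subgraph.star v) e hU he))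
          (φ.imageEdges (U.join (Subgraph.star v) e hU he))
        = nodes (φ.imageVerts U) (φ.imageEdges U) ∪ nodes (φ.sub v).verts (φ.sub v).edges := by
      rw [imageVerts_join, imageEdges_join]
      ext (w | f) <;> simp
    rw [h]
    exact SimpleGraph.induce_union_connected ih.preconnected (φ.sub v).connected.preconnected
      ⟨Sum.inr (φ.edge e), Or.inl ⟨e, hU, rfl⟩, φ.edge_mem_sub he⟩

/-- The image of the restriction of a morphism `φ : R → S` to a subgraph `T` of `R`. If `T` has a
vertex it is the union of the subgraphs `φ₁ v`, where `v` runs over the vertices of `T` (the edges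
`φ₀ e`, with `e` in `T`, are then contained in that union); if `T` is a single edge `e`, then it is
the single edge `φ₀ e`. -/
def imageOn (T : Subgraph R) : Subgraph S where
  verts := φ.imageVerts T
  edges := φ.imageEdges T
  closed w hw := by
    simp only [imageVerts, Set.mem_iUnion] at hw
    obtain ⟨v, hv, hw⟩ := hw
    exact ((φ.sub v).closed w hw).trans
      ((Set.subset_biUnion_of_mem (u := fun v => (φ.sub v).edges) hv).trans
        Set.subset_union_right)
  contractible := contractible_of_connected _ _ _ (φ.image_connected T)

/-- The image of a morphism, a subgraph of the target. -/
def image : Subgraph S := φ.imageOn (Subgraph.whole R)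

theorem image_eq_single (hR : IsEmpty R.V) (e : R.E) :
    φ.image = Subgraph.single (φ.edge e) := by
  have hE : ∀ f : R.E, f = e := fun f =>
    (Subgraph.whole R).edges_inter_subsingleton (Subgraph.whole R)
      (Set.disjoint_left.2 fun v => hR.elim v) trivial trivial trivial trivial
  apply Subgraph.ext
  · ext w
    simp [image, imageOn, imageVerts, Subgraph.single]
  · ext f
    simp only [image, imageOn, imageEdges, Subgraph.single, Subgraph.whole, Set.mem_union,
      Set.mem_singleton_iff, Set.iUnion_of_empty, Set.mem_empty_iff_false, or_false]
    constructor
    · rintro ⟨g, -, rfl⟩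
      rw [hE g]
    · rintro rfl
      exact ⟨e, trivial, rfl⟩

theorem image_eq_iUnion (hR : Nonempty R.V) :
    φ.image.verts = ⋃ v, (φ.sub v).verts ∧ φ.image.edges = ⋃ v, (φ.sub v).edges := by
  refine ⟨by simp [image, imageOn, imageVerts, Subgraph.whole], ?_⟩
  simp only [image, imageOn, imageEdges, Subgraph.whole, Set.mem_univ, Set.iUnion_true,
    Set.union_eq_right]
  rintro _ ⟨e, -, rfl⟩
  obtain ⟨v⟩ := hR
  obtain ⟨f, hf, -, w, -, -, hfw⟩ := (Subgraph.whole R).exists_crossing (W := ∅) (F := {e})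
    (by simp) rfl trivial (x := Sum.inl v) trivial (by simp)
  obtain rfl : f = e := hf
  exact Set.mem_iUnion.2 ⟨w, φ.edge_mem_sub hfw⟩

theorem imageOn_star (v : R.V) : φ.imageOn (Subgraph.star v) = φ.sub v := by
  apply Subgraph.ext
  · simp [imageOn, imageVerts, Subgraph.star]
  · change φ.edge '' R.nbhd v ∪ (⋃ w ∈ ({v} : Set R.V), (φ.sub w).edges) = _
    rw [Set.biUnion_singleton, Set.union_eq_right]
    rintro _ ⟨e, he, rfl⟩
    exact φ.edge_mem_sub he

theorem boundary_imageOn (T : Subgraph R) :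
    (φ.imageOn T).boundary = T.boundary.map φ.edge := by
  induction T using Subgraph.induction with
  | hsingle e =>
    have : φ.imageOn (Subgraph.single e) = Subgraph.single (φ.edge e) := by
      apply Subgraph.ext
      · change (⋃ v ∈ (∅ : Set R.V), (φ.sub v).verts) = ∅
        simp
      · change φ.edge '' {e} ∪ (⋃ v ∈ (∅ : Set R.V), (φ.sub v).edges) = {φ.edge e}
        simp
    rw [this, Subgraph.boundary_single, Subgraph.boundary_single, Multiset.map_nsmul,
      Multiset.map_singleton]
  | hjoin U v e hv hU he ih =>
    have h1 := Subgraph.boundary_glue U (Subgraph.star v) (U.join (Subgraph.star v) e hU he)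
      (Set.disjoint_singleton_right.2 hv) hU he rfl rfl
    have h2 := Subgraph.boundary_glue (φ.imageOn U) (φ.sub v)
      (φ.imageOn (U.join (Subgraph.star v) e hU he)) (e := φ.edge e)
      (by
        refine Set.disjoint_left.2 fun w hw hw' => ?_
        simp only [imageOn, imageVerts, Set.mem_iUnion] at hw
        obtain ⟨u, hu, hw⟩ := hw
        exact Set.disjoint_left.1 (φ.disjoint_sub u v fun h => hv (h ▸ hu)) hw hw')
      (Or.inl ⟨e, hU, rfl⟩) (φ.edge_mem_sub he)
      (φ.imageVerts_join U v hU he) (φ.imageEdges_join U v hU he)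
    rw [Subgraph.boundary_star] at h1
    rw [ih, φ.boundary_sub, ← Multiset.map_add, ← h1, Multiset.map_add] at h2
    rw [Multiset.map_nsmul, Multiset.map_singleton] at h2
    exact add_right_cancel h2

/-- The identity: the identity on edges, and `v ↦ ⋆_v` on vertices. -/
def id (R : UnpinnedTree.{u}) : Morphism R R where
  edge e := e
  sub := Subgraph.star
  injOn_nbhd _ _ := fun _ _ _ _ h => h
  boundary_sub v := by rw [Subgraph.boundary_star, Multiset.map_id']
  disjoint_sub v w h := Set.disjoint_singleton.2 h

/-- The composition `ψ ∘ φ` (in diagrammatic order): composition on edges, and on vertices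
`(ψ ∘ φ)₁ v` is the image of the restriction of `ψ` to `φ₁ v`. -/
def comp (φ : Morphism R S) (ψ : Morphism S Q) : Morphism R Q where
  edge e := ψ.edge (φ.edge e)
  sub v := ψ.imageOn (φ.sub v)
  boundary_sub v := by
    rw [boundary_imageOn, φ.boundary_sub, Multiset.map_map]
    rfl
  injOn_nbhd v hv := by
    have hb : (ψ.imageOn (φ.sub v)).boundary
        = (nbhdList R v).map (fun e => ψ.edge (φ.edge e)) := by
      rw [boundary_imageOn, φ.boundary_sub, Multiset.map_map]
      rfl
    have hne : (ψ.imageOn (φ.sub v)).verts ≠ ∅ := by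
      intro h
      have hc := Subgraph.card_boundary_of_no_vertex _ h
      rw [hb, Multiset.card_map] at hc
      apply hv
      rw [Set.ncard_eq_toFinset_card _ (Set.toFinite _)]
      exact hc
    have hnd := Subgraph.boundary_nodup _ hne
    rw [hb] at hnd
    intro a ha b hb' hab
    exact Multiset.inj_on_of_nodup_map hnd a (by simpa [nbhdList] using ha) b
      (by simpa [nbhdList] using hb') hab
  disjoint_sub v w hvw := by
    refine Set.disjoint_left.2 fun x hx hx' => ?_
    simp only [imageOn, imageVerts, Set.mem_iUnion] at hx hx'
    obtain ⟨a, ha, hx⟩ := hx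
    obtain ⟨b, hb, hx'⟩ := hx'
    have hab : a = b := by
      by_contra hne
      exact Set.disjoint_left.1 (ψ.disjoint_sub a b hne) hx hx'
    subst hab
    exact Set.disjoint_left.1 (φ.disjoint_sub v w hvw) ha hb

theorem id_imageOn (T : Subgraph R) : (id R).imageOn T = T := by
  apply Subgraph.ext
  · ext v
    simp [imageOn, imageVerts, id, Subgraph.star]
  · simp only [imageOn, imageEdges, id, Subgraph.star, Set.image_id', Set.union_eq_left]
    exact Set.iUnion₂_subset T.closed

theorem comp_imageOn (φ : Morphism R S) (ψ : Morphism S Q) (T : Subgraph R) :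
    (φ.comp ψ).imageOn T = ψ.imageOn (φ.imageOn T) := by
  apply Subgraph.ext
  · ext x
    simp only [imageOn, imageVerts, comp, Set.mem_iUnion, exists_prop]
    constructor
    · rintro ⟨v, hv, w, hw, hx⟩
      exact ⟨w, ⟨v, hv, hw⟩, hx⟩
    · rintro ⟨w, ⟨v, hv, hw⟩, hx⟩
      exact ⟨v, hv, w, hw, hx⟩
  · ext x
    simp only [imageOn, imageEdges, imageVerts, comp, Set.mem_iUnion, exists_prop, Set.mem_union,
      Set.mem_image]
    constructor
    · rintro (⟨e, he, rfl⟩ | ⟨v, hv, ⟨e, he, rfl⟩ | ⟨w, hw, hx⟩⟩)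
      · exact Or.inl ⟨_, Or.inl ⟨e, he, rfl⟩, rfl⟩
      · exact Or.inl ⟨e, Or.inr ⟨v, hv, he⟩, rfl⟩
      · exact Or.inr ⟨w, ⟨v, hv, hw⟩, hx⟩
    · rintro (⟨_, ⟨e, he, rfl⟩ | ⟨v, hv, he⟩, rfl⟩ | ⟨w, ⟨v, hv, hw⟩, hx⟩)
      · exact Or.inl ⟨e, he, rfl⟩
      · exact Or.inr ⟨v, hv, Or.inl ⟨_, he, rfl⟩⟩
      · exact Or.inr ⟨v, hv, Or.inr ⟨w, hw, hx⟩⟩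

end Morphism

/-- The category `Ξ` of trees. -/
instance : Category.{u} Tree.{u} where
  Hom R S := Morphism R.toUnpinnedTree S.toUnpinnedTree
  id R := Morphism.id R.toUnpinnedTree
  comp φ ψ := Morphism.comp φ ψ
  id_comp φ := by
    refine Morphism.ext rfl ?_
    funext v
    exact φ.imageOn_star v
  comp_id φ := by
    refine Morphism.ext rfl ?_
    funext v
    exact Morphism.id_imageOn _
  assoc φ ψ χ := by
    refine Morphism.ext rfl ?_
    funext v
    exact (Morphism.comp_imageOn ψ χ _).symm

/-- The inclusion of a subgraph of a tree `S` (with any pinning) as a morphism of `Ξ`. -/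
def Subgraph.inclusion {S : Tree.{u}} (T : Subgraph S.toUnpinnedTree)
    (p : Pinning T.toUnpinned) : T.toTree p ⟶ S :=
  show Morphism T.toUnpinned S.toUnpinnedTree from
  { edge := fun e => e.1
    sub := fun v => Subgraph.star v.1
    injOn_nbhd := fun _ _ _ _ _ _ h => Subtype.ext h
    boundary_sub := fun v => by
      have h : Function.Injective (fun e : T.toUnpinned.E => e.1) := Subtype.val_injective
      rw [Subgraph.boundary_star]
      refine (Multiset.Nodup.ext (Finset.nodup _) (Multiset.Nodup.map h (Finset.nodup _))).2 ?_
      intro e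
      simp only [Finset.mem_val, Set.Finite.mem_toFinset, Multiset.mem_map]
      constructor
      · intro he
        exact ⟨⟨e, T.closed v.1 v.2 he⟩, he, rfl⟩
      · rintro ⟨f, hf, rfl⟩
        exact hf
    disjoint_sub := fun v w hvw =>
      Set.disjoint_singleton.2 fun h => hvw (Subtype.ext h) }

/-- Every unpinned tree has a pinning. -/
theorem Pinning.exists_pinning (U : UnpinnedTree.{u}) : Nonempty (Pinning U) := by
  classical
  obtain ⟨l, hl⟩ := U.legs_nonempty
  by_cases hV : Nonempty U.V
  · obtain ⟨n, ⟨f⟩⟩ := Finite.exists_equiv_fin U.legs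
    obtain ⟨m, rfl⟩ : ∃ m, n = m + 1 :=
      Nat.exists_eq_succ_of_ne_zero (by rintro rfl; exact (f ⟨l, hl⟩).elim0)
    exact ⟨⟨m, f.symm, fun _ => f.symm.bijective, fun h => (not_isEmpty_of_nonempty U.V h).elim⟩⟩
  · exact ⟨⟨1, fun _ => ⟨l, hl⟩, fun h => (hV h).elim, fun _ => rfl⟩⟩

/-- Active morphisms: those whose image is the whole target. -/
def active : MorphismProperty Tree.{u} := fun _ S φ =>
  Morphism.image φ = Subgraph.whole S.toUnpinnedTree

/-- Inert morphisms: `φ₀` is injective, and all edges incident to a vertex of some `φ₁ v` lie in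
the image of `φ₀`. -/
def inert : MorphismProperty Tree.{u} := fun R S φ =>
  Function.Injective (Morphism.edge φ) ∧
    ∀ (v : R.V) (w : S.V), w ∈ (Morphism.sub φ v).verts → S.nbhd w ⊆ Set.range (Morphism.edge φ)

end CyclicTree

/-!
The proof rests on the observation that an inert morphism `p : X → Y` is, up to isomorphism, the
inclusion of a subgraph. It sends each vertex `v` to a star `⋆_w` (`inert.exists_sub_eq_star`): two
vertices of `p₁ v` joined by an edge `p₀ e` would leave no room for a vertex of `Y` coming from the
other side of `e`, since an edge is incident to at most two vertices. Hence taking images of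
subgraphs along `p` is injective (`inert.imageOn_injective`), so `p` is a monomorphism, and every
subgraph of `Y` contained in the image of `p` is the image of a subgraph of `X`
(`inert.exists_imageOn_eq`). Consequently a morphism `g : B → Y` factors through `p` as soon as its
image is contained in that of `p` (`inert.exists_lift`).

This one lifting lemma gives everything except stability under retracts. Applied to the inclusion
of the image of `φ`, it yields the active-inert factorization of `φ`. In a square from an active
`i` to an inert `p`, the image of the bottom arrow `g` is that of `i ≫ g`, hence is contained in the
image of `p`, so `g` lifts through `p`; the upper triangle commutes because `p` is a monomorphism.
Both classes are stable under retracts, and the retract argument turns these facts into a weak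
factorization system.
-/

namespace CyclicTree

/-! ### Incidence in subgraphs and images -/

/-- In a subgraph with a vertex, connectedness makes every edge incident to a vertex of the
subgraph. -/
theorem Subgraph.exists_vertex_of_mem_edges {S : UnpinnedTree.{u}} (T : Subgraph S)
    (hT : T.verts.Nonempty) {e : S.E} (he : e ∈ T.edges) : ∃ v ∈ T.verts, e ∈ S.nbhd v := by
  obtain ⟨v, hv⟩ := hT
  obtain ⟨f, hf, -, w, hw, -, hfw⟩ := T.exists_crossing (W := ∅) (F := {e}) (by simp) rfl he
    (x := Sum.inl v) hv (by simp)
  obtain rfl : f = e := hf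
  exact ⟨w, hw, hfw⟩

theorem Subgraph.notMem_boundary {S : UnpinnedTree.{u}} (T : Subgraph S) {v w : S.V} {e : S.E}
    (hv : v ∈ T.verts) (hw : w ∈ T.verts) (hne : v ≠ w) (hev : e ∈ S.nbhd v)
    (hew : e ∈ S.nbhd w) : e ∉ T.boundary := by
  classical
  intro h
  have h1 := T.count_boundary e
  rw [if_pos (T.closed v hv hev)] at h1
  have h2 : 1 < {v | v ∈ T.verts ∧ e ∈ S.nbhd v}.ncard :=
    (Set.one_lt_ncard (Set.toFinite _)).2 ⟨v, ⟨hv, hev⟩, w, ⟨hw, hew⟩, hne⟩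
  have h3 := Multiset.count_pos.2 h
  omega

@[simp] theorem mem_nbhdList {S : UnpinnedTree.{u}} {v : S.V} {e : S.E} :
    e ∈ nbhdList S v ↔ e ∈ S.nbhd v := by
  simp [nbhdList]

namespace Morphism

variable {R S Q : UnpinnedTree.{u}}

theorem mem_imageOn_verts (φ : Morphism R S) {T : Subgraph R} {w : S.V} :
    w ∈ (φ.imageOn T).verts ↔ ∃ v ∈ T.verts, w ∈ (φ.sub v).verts := by
  simp [imageOn, imageVerts]

theorem imageOn_mono (φ : Morphism R S) {A B : Subgraph R} (hV : A.verts ⊆ B.verts)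
    (hE : A.edges ⊆ B.edges) :
    (φ.imageOn A).verts ⊆ (φ.imageOn B).verts ∧ (φ.imageOn A).edges ⊆ (φ.imageOn B).edges :=
  ⟨Set.biUnion_subset_biUnion_left hV,
    Set.union_subset_union (Set.image_mono hE) (Set.biUnion_subset_biUnion_left hV)⟩

theorem imageOn_subset_image (φ : Morphism R S) (T : Subgraph R) :
    (φ.imageOn T).verts ⊆ φ.image.verts ∧ (φ.imageOn T).edges ⊆ φ.image.edges :=
  φ.imageOn_mono (Set.subset_univ _) (Set.subset_univ _)

theorem image_comp (φ : Morphism R S) (ψ : Morphism S Q) :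
    (φ.comp ψ).image = ψ.imageOn φ.image :=
  comp_imageOn φ ψ _

/-- A vertex can only be sent to a single edge by collapsing its two edges, so this does not happen
when the map on edges is injective. -/
theorem sub_verts_nonempty (φ : Morphism R S) (h : Function.Injective φ.edge) (v : R.V) :
    (φ.sub v).verts.Nonempty := by
  classical
  rw [Set.nonempty_iff_ne_empty]
  intro hv
  obtain ⟨e, he⟩ := (φ.sub v).edges_nonempty
  have hc := (φ.sub v).count_boundary e
  have hnd : (φ.sub v).boundary.Nodup := by
    rw [φ.boundary_sub]
    exact Multiset.Nodup.map h (Finset.nodup _)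
  have h1 := Multiset.nodup_iff_count_le_one.1 hnd e
  have h2 : {w | w ∈ (φ.sub v).verts ∧ e ∈ S.nbhd w} = ∅ := by simp [hv]
  rw [h2, Set.ncard_empty, if_pos he] at hc
  omega

end Morphism

/-! ### The structure of inert morphisms -/

namespace inert

variable {X Y : Tree.{u}} {p : X ⟶ Y}

theorem exists_sub_eq_star (hp : inert p) (v : X.V) :
    ∃ w, Morphism.sub p v = Subgraph.star w := by
  have hne := Morphism.sub_verts_nonempty p hp.1
  obtain ⟨w, hw⟩ := hne v
  refine ⟨w, ?_⟩
  by_contra hcon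
  obtain ⟨x, hx, hxw⟩ : ∃ x, x ∈ nodes (Morphism.sub p v).verts (Morphism.sub p v).edges ∧
      x ∉ nodes {w} (Y.nbhd w) := by
    by_contra! h
    refine hcon (Subgraph.ext_nodes fun x => ⟨h x, ?_⟩)
    rcases x with u | e
    · rintro rfl
      exact hw
    · exact fun he => (Morphism.sub p v).closed w hw he
  obtain ⟨e₀, he₀⟩ := Subgraph.ordAt_nonempty w
  -- If `p₁ v` is larger than `⋆_w`, it has a second vertex `u` and an edge `p₀ e` joining it to `w`.
  obtain ⟨f, hfw, -, u, hu, huw, hfu⟩ := (Morphism.sub p v).exists_crossing (W := {w})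
    (F := Y.nbhd w) (by rintro _ rfl; exact subset_rfl) he₀
    ((Morphism.sub p v).closed w hw he₀) hx hxw
  have huw' : u ≠ w := huw
  obtain ⟨e, rfl⟩ := hp.2 v w hw hfw
  obtain ⟨v', -, hv'⟩ := (Subgraph.whole X.toUnpinnedTree).exists_vertex_of_mem_edges
    ⟨v, trivial⟩ (e := e) trivial
  by_cases hvv : v' = v
  · subst hvv
    refine (Morphism.sub p v').notMem_boundary hu hw huw' hfu hfw ?_
    rw [Morphism.boundary_sub]
    exact Multiset.mem_map_of_mem _ (mem_nbhdList.2 hv')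
  · -- A vertex of `p₁ v'` incident to `p₀ e` is the third one besides `u` and `w`.
    obtain ⟨y, hy, hey⟩ := (Morphism.sub p v').exists_vertex_of_mem_edges (hne v')
      (Morphism.edge_mem_sub p hv')
    have hd := Set.disjoint_left.1 (Morphism.disjoint_sub p v' v hvv) hy
    have hthree : 2 < {z | Morphism.edge p e ∈ Y.nbhd z}.ncard :=
      (Set.two_lt_ncard (Set.toFinite _)).2 ⟨u, hfu, w, hfw, y, hey, huw',
        fun h => hd (h ▸ hu), fun h => hd (h ▸ hw)⟩
    exact hthree.not_ge (Y.incident_le_two _)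

/-- An inert morphism is given on vertices by an injective function, compatible with
neighbourhoods. -/
theorem exists_vertex_map (hp : inert p) : ∃ ν : X.V → Y.V, Function.Injective ν ∧
    (∀ v, Morphism.sub p v = Subgraph.star (ν v)) ∧
    ∀ v, Y.nbhd (ν v) = Morphism.edge p '' X.nbhd v := by
  choose ν hν using hp.exists_sub_eq_star
  refine ⟨ν, fun v w h => ?_, hν, fun v => ?_⟩
  · by_contra hne
    have := Morphism.disjoint_sub p v w hne
    rw [hν, hν, h] at this
    exact Set.disjoint_left.1 this rfl rfl
  · have := Morphism.boundary_sub p v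
    rw [hν, Subgraph.boundary_star] at this
    ext e
    rw [← mem_nbhdList, this]
    simp

theorem imageOn_eq_image (hp : inert p) {ν : X.V → Y.V}
    (hν : ∀ v, Morphism.sub p v = Subgraph.star (ν v)) (T : Subgraph X.toUnpinnedTree) :
    (Morphism.imageOn p T).verts = ν '' T.verts ∧
      (Morphism.imageOn p T).edges = Morphism.edge p '' T.edges := by
  constructor
  · ext w
    rw [Morphism.mem_imageOn_verts]
    simp only [hν, Set.mem_image]
    exact ⟨fun ⟨v, hv, h⟩ => ⟨v, hv, Eq.symm h⟩, fun ⟨v, hv, h⟩ => ⟨v, hv, Eq.symm h⟩⟩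
  · refine Set.union_eq_left.2 (Set.iUnion₂_subset fun v hv => ?_)
    intro e he
    obtain ⟨w, hw⟩ := hp.exists_sub_eq_star v
    rw [hw] at he
    have : e ∈ (Morphism.sub p v).boundary := by
      rw [hw, Subgraph.boundary_star]
      exact mem_nbhdList.2 he
    rw [Morphism.boundary_sub, Multiset.mem_map] at this
    obtain ⟨f, hf, rfl⟩ := this
    exact ⟨f, T.closed v hv (mem_nbhdList.1 hf), rfl⟩

theorem imageOn_injective (hp : inert p) : Function.Injective (Morphism.imageOn p) := by
  obtain ⟨ν, hinj, hν, -⟩ := hp.exists_vertex_map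
  intro A B h
  obtain ⟨hA, hA'⟩ := hp.imageOn_eq_image hν A
  obtain ⟨hB, hB'⟩ := hp.imageOn_eq_image hν B
  rw [h] at hA hA'
  exact Subgraph.ext (hinj.image_injective (hA.symm.trans hB))
    (hp.1.image_injective (hA'.symm.trans hB'))

theorem mono (hp : inert p) : Mono p where
  right_cancellation {Z} g h hgh := by
    refine Morphism.ext (funext fun e => hp.1 ?_) (funext fun v => hp.imageOn_injective ?_)
    · exact congrFun (congrArg Morphism.edge hgh) e
    · exact congrFun (congrArg Morphism.sub hgh) v

/-- Subgraphs pull back along inert morphisms: `p` restricts to an isomorphism of incidence graphs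
from the preimage of `T` to `T`, so the preimage is connected. -/
theorem exists_imageOn_eq (hp : inert p) (T : Subgraph Y.toUnpinnedTree)
    (hV : T.verts ⊆ (Morphism.image p).verts) (hE : T.edges ⊆ (Morphism.image p).edges) :
    ∃ U : Subgraph X.toUnpinnedTree, Morphism.imageOn p U = T := by
  obtain ⟨ν, hinj, hν, hnbhd⟩ := hp.exists_vertex_map
  obtain ⟨h1, h2⟩ := hp.imageOn_eq_image hν (Subgraph.whole _)
  replace hV : T.verts ⊆ Set.range ν := hV.trans (h1.le.trans (Set.image_subset_range _ _))
  replace hE : T.edges ⊆ Set.range (Morphism.edge p) :=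
    hE.trans (h2.le.trans (Set.image_subset_range _ _))
  have hmem : ∀ v e, Morphism.edge p e ∈ Y.nbhd (ν v) ↔ e ∈ X.nbhd v := fun v e => by
    rw [hnbhd, hp.1.mem_set_image]
  let F : nodes (S := X.toUnpinnedTree) (ν ⁻¹' T.verts) (Morphism.edge p ⁻¹' T.edges) →
      nodes T.verts T.edges := fun x => match x with
    | ⟨.inl v, hv⟩ => ⟨.inl (ν v), hv⟩
    | ⟨.inr e, he⟩ => ⟨.inr (Morphism.edge p e), he⟩
  have hF : Function.Bijective F := by
    constructor
    · rintro ⟨v | e, hx⟩ ⟨w | f, hy⟩ h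
      · obtain rfl := hinj (Sum.inl.inj (congrArg Subtype.val h))
        rfl
      · exact (Sum.inl_ne_inr (congrArg Subtype.val h)).elim
      · exact (Sum.inr_ne_inl (congrArg Subtype.val h)).elim
      · obtain rfl := hp.1 (Sum.inr.inj (congrArg Subtype.val h))
        rfl
    · rintro ⟨w | f, hy⟩
      · obtain ⟨v, rfl⟩ := hV hy
        exact ⟨⟨.inl v, hy⟩, rfl⟩
      · obtain ⟨e, rfl⟩ := hE hy
        exact ⟨⟨.inr e, hy⟩, rfl⟩
  let iso : X.incidence.induce
      (nodes (S := X.toUnpinnedTree) (ν ⁻¹' T.verts) (Morphism.edge p ⁻¹' T.edges)) ≃g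
      Y.incidence.induce (nodes T.verts T.edges) :=
    { toEquiv := Equiv.ofBijective F hF
      map_rel_iff' := by
        rintro ⟨v | e, hx⟩ ⟨w | f, hy⟩
        · exact Iff.rfl
        · exact hmem v f
        · exact hmem w e
        · exact Iff.rfl }
  let U : Subgraph X.toUnpinnedTree :=
    { verts := ν ⁻¹' T.verts
      edges := Morphism.edge p ⁻¹' T.edges
      closed := fun v hv e he => T.closed _ hv ((hmem v e).2 he)
      contractible := contractible_of_connected _ _ _ (iso.connected_iff.2 T.connected) }
  obtain ⟨h3, h4⟩ := hp.imageOn_eq_image hν U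
  refine ⟨U, Subgraph.ext ?_ ?_⟩
  · rw [h3]
    exact Set.image_preimage_eq_of_subset hV
  · rw [h4]
    exact Set.image_preimage_eq_of_subset hE

/-- A morphism whose image is contained in that of an inert morphism `p` factors through `p`. -/
theorem exists_lift (hp : inert p) {B : Tree.{u}} (g : B ⟶ Y)
    (hV : (Morphism.image g).verts ⊆ (Morphism.image p).verts)
    (hE : (Morphism.image g).edges ⊆ (Morphism.image p).edges) : ∃ h : B ⟶ X, h ≫ p = g := by
  obtain ⟨ν, -, hν, -⟩ := hp.exists_vertex_map
  have hedge : ∀ e, ∃ x, Morphism.edge p x = Morphism.edge g e := fun e => by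
    have he : Morphism.edge g e ∈ (Morphism.image p).edges := hE (Or.inl ⟨e, trivial, rfl⟩)
    have := (hp.imageOn_eq_image hν (Subgraph.whole _)).2.le he
    exact this.imp fun _ h => h.2
  have hsub : ∀ v, ∃ U, Morphism.imageOn p U = Morphism.sub g v := fun v => by
    obtain ⟨h1, h2⟩ := Morphism.imageOn_subset_image g (Subgraph.star v)
    rw [Morphism.imageOn_star] at h1 h2
    exact hp.exists_imageOn_eq _ (h1.trans hV) (h2.trans hE)
  choose ε hε using hedge
  choose σ hσ using hsub
  let h : Morphism B.toUnpinnedTree X.toUnpinnedTree :=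
    { edge := ε
      sub := σ
      injOn_nbhd := fun v hv a ha b hb hab =>
        Morphism.injOn_nbhd g v hv ha hb (by rw [← hε, ← hε, hab])
      boundary_sub := fun v => by
        -- Both sides are determined by their images under the injection `p₀`.
        refine Multiset.map_injective hp.1 ?_
        rw [← Morphism.boundary_imageOn, hσ, Morphism.boundary_sub, Multiset.map_map]
        exact Multiset.map_congr rfl fun e _ => (hε e).symm
      disjoint_sub := fun v w hvw => by
        refine Set.disjoint_left.2 fun x hx hx' => ?_
        have hd := Morphism.disjoint_sub g v w hvw
        rw [← hσ, ← hσ, (hp.imageOn_eq_image hν _).1, (hp.imageOn_eq_image hν _).1] at hd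
        exact Set.disjoint_left.1 hd ⟨x, hx, rfl⟩ ⟨x, hx', rfl⟩ }
  exact ⟨h, Morphism.ext (funext hε) (funext hσ)⟩

end inert

/-! ### Factorization through the image -/

theorem inert_inclusion {S : Tree.{u}} (T : Subgraph S.toUnpinnedTree)
    (p : Pinning T.toUnpinned) : inert (T.inclusion p) := by
  refine ⟨Subtype.val_injective, ?_⟩
  rintro v w rfl e he
  exact ⟨⟨e, T.closed v.1 v.2 he⟩, rfl⟩

theorem image_inclusion {S : Tree.{u}} (T : Subgraph S.toUnpinnedTree)
    (p : Pinning T.toUnpinned) : Morphism.image (T.inclusion p) = T := by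
  obtain ⟨h1, h2⟩ := (inert_inclusion T p).imageOn_eq_image (ν := Subtype.val) (fun _ => rfl)
    (Subgraph.whole T.toUnpinned)
  apply Subgraph.ext
  · exact h1.trans (Set.image_univ.trans Subtype.range_val)
  · exact h2.trans (Set.image_univ.trans Subtype.range_val)

theorem exists_active_comp_inclusion {R S : Tree.{u}} (φ : R ⟶ S)
    (p : Pinning (Morphism.image φ).toUnpinned) :
    ∃ α : R ⟶ (Morphism.image φ).toTree p,
      active α ∧ α ≫ (Morphism.image φ).inclusion p = φ := by
  have hp := inert_inclusion _ p
  have himg := image_inclusion _ p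
  obtain ⟨α, hα⟩ := hp.exists_lift φ (by rw [himg]) (by rw [himg])
  refine ⟨α, hp.imageOn_injective ?_, hα⟩
  refine (Morphism.image_comp α ((Morphism.image φ).inclusion p)).symm.trans ?_
  exact (congrArg Morphism.image hα).trans himg.symm

instance : MorphismProperty.HasFactorization active.{u} inert.{u} where
  nonempty_mapFactorizationData {R S} φ := by
    obtain ⟨p⟩ := Pinning.exists_pinning (Morphism.image φ).toUnpinned
    obtain ⟨α, hα, hφ⟩ := exists_active_comp_inclusion φ p
    exact ⟨{ Z := _, i := α, p := _, fac := hφ, hi := hα, hp := inert_inclusion _ p }⟩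

/-! ### Lifting and stability under retracts -/

theorem active.hasLiftingProperty {A B X Y : Tree.{u}} {i : A ⟶ B} {p : X ⟶ Y}
    (hi : active i) (hp : inert p) : HasLiftingProperty i p where
  sq_hasLift {f g} sq := by
    have himg : Morphism.image g = Morphism.imageOn p (Morphism.image f) := by
      have h1 := Morphism.image_comp i g
      have h2 := Morphism.image_comp f p
      rw [show Morphism.image i = _ from hi] at h1
      exact h1.symm.trans ((congrArg Morphism.image sq.w.symm).trans h2)
    obtain ⟨hV, hE⟩ := Morphism.imageOn_subset_image p (Morphism.image f)
    rw [← himg] at hV hE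
    obtain ⟨h, hh⟩ := hp.exists_lift g hV hE
    have := hp.mono
    refine ⟨⟨⟨h, ?_, hh⟩⟩⟩
    rw [← cancel_mono p, Category.assoc, hh, sq.w]

theorem active.of_comp {X Y Z : Tree.{u}} {f : X ⟶ Y} {g : Y ⟶ Z} (h : active (f ≫ g)) :
    active g := by
  obtain ⟨hV, hE⟩ := Morphism.imageOn_subset_image g (Morphism.image f)
  have h' : Morphism.imageOn g (Morphism.image f) = _ := (Morphism.image_comp f g).symm.trans h
  rw [h'] at hV hE
  exact Subgraph.ext (Set.univ_subset_iff.1 hV) (Set.univ_subset_iff.1 hE)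

theorem active.comp {X Y Z : Tree.{u}} {f : X ⟶ Y} {g : Y ⟶ Z} (hf : active f)
    (hg : active g) : active (f ≫ g) := by
  refine (Morphism.image_comp f g).trans ?_
  rw [show Morphism.image f = _ from hf]
  exact hg

theorem active_id (X : Tree.{u}) : active (𝟙 X) :=
  Morphism.id_imageOn _

instance : active.{u}.IsStableUnderRetracts where
  of_retract {X Y Z W f g} r hg := by
    have h1 : active r.right.r := active.of_comp (f := r.right.i) (by
      rw [r.right.retract]
      exact active_id _)
    have h2 := hg.comp h1
    have h3 : active (r.left.r ≫ f) := by
      rwa [show r.left.r ≫ f = g ≫ r.right.r from r.r_w]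
    exact h3.of_comp

instance : inert.{u}.IsStableUnderRetracts where
  of_retract {X Y Z W f g} r hg := by
    have hret : ∀ {A B : Tree.{u}} (r : Retract A B) (e : A.E),
        Morphism.edge r.r (Morphism.edge r.i e) = e :=
      fun r => congrFun (congrArg Morphism.edge r.retract)
    have hw : ∀ e, Morphism.edge g (Morphism.edge r.left.i e)
        = Morphism.edge r.right.i (Morphism.edge f e) :=
      congrFun (congrArg Morphism.edge r.i_w)
    have hr : ∀ e, Morphism.edge f (Morphism.edge r.left.r e)
        = Morphism.edge r.right.r (Morphism.edge g e) :=
      congrFun (congrArg Morphism.edge r.r_w)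
    have hs : ∀ v, Morphism.imageOn g (Morphism.sub r.left.i v)
        = Morphism.imageOn r.right.i (Morphism.sub f v) :=
      congrFun (congrArg Morphism.sub r.i_w)
    refine ⟨fun a b hab => ?_, fun v w hwv e he => ?_⟩
    · have : Morphism.edge r.left.i a = Morphism.edge r.left.i b :=
        hg.1 (by rw [hw, hw, hab])
      rw [← hret r.left a, this, hret]
    · -- The image of `e` in the middle tree is incident to a vertex coming from `w`, hence to one
      -- of the image of `g`; therefore it lies in the range of `g` and retracts into that of `f`.
      have hne := Morphism.sub_verts_nonempty r.right.i
        (Function.LeftInverse.injective (hret r.right)) w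
      obtain ⟨w', hw', hew'⟩ := (Morphism.sub r.right.i w).exists_vertex_of_mem_edges hne
        (Morphism.edge_mem_sub r.right.i he)
      have hmem : w' ∈ (Morphism.imageOn r.right.i (Morphism.sub f v)).verts :=
        (Morphism.mem_imageOn_verts _).2 ⟨w, hwv, hw'⟩
      rw [← hs, Morphism.mem_imageOn_verts] at hmem
      obtain ⟨v', -, hv'⟩ := hmem
      obtain ⟨z, hz⟩ := hg.2 v' w' hv' hew'
      exact ⟨Morphism.edge r.left.r z, by rw [hr, hz, hret]⟩

end CyclicTree

theorem proposition4p5 :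
    (CyclicTree.active.{u}).IsWeakFactorizationSystem CyclicTree.inert.{u} ∧
    ∀ ⦃R S : CyclicTree.Tree.{u}⦄ (φ : R ⟶ S)
      (p : CyclicTree.Pinning (CyclicTree.Morphism.image φ).toUnpinned),
      ∃ α : R ⟶ (CyclicTree.Morphism.image φ).toTree p,
        CyclicTree.active α ∧ CyclicTree.inert ((CyclicTree.Morphism.image φ).inclusion p) ∧
          α ≫ (CyclicTree.Morphism.image φ).inclusion p = φ := by
  refine ⟨MorphismProperty.IsWeakFactorizationSystem.mk' _ _
    fun _ _ hi hp => hi.hasLiftingProperty hp, fun R S φ p => ?_⟩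
  obtain ⟨α, hα, hφ⟩ := CyclicTree.exists_active_comp_inclusion φ p
  exact ⟨α, hα, CyclicTree.inert_inclusion _ p, hφ⟩
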